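/- Conventions. Fix an algebraic language; algebras are non-empty. For an algebra $\mathbf{B}$, $\mathbb{ISP}(\mathbf{B})$ is the class of algebras isomorphic to a subalgebra of some power $\mathbf{B}^I$ ($I=\emptyset$ allowed). Let $\mathbf{M}$ be a finite algebra. An alter ego of $\mathbf{M}$ is a structure $\widetilde{\mathbf{M}}=(M;G,H,R,\mathcal{T})$ with $\mathcal{T}$ the discrete topology, where each $n$-ary $g\in G$ ($n\ge 0$) is a homomorphism $\mathbf{M}^n\to\mathbf{M}$, each $n$-ary $h\in H$ ($n\ge1$) is a homomorphism from a subalgebra of $\mathbf{M}^n$ into $\mathbf{M}$, and each $n$-ary $r\in R$ ($n\ge1$) is the universe of a subalgebra of $\mathbf{M}^n$. A substructure is a subset closed under $G$ and $H$, with the induced structure (it may be empty if $G$ has no nullary operation), and $\langle S\rangle$ is the smallest substructure containing $S$. Let $\mathcal{A}=\mathbb{ISP}(\mathbf{M})$, and let $\mathcal{X}=\mathbb{IS}_c\mathbb{P}(\widetilde{\mathbf{M}})$ be the category of structured spaces isomorphic to a closed (possibly empty) substructure of a power $\widetilde{\mathbf{M}}^S$ with $S\neq\emptyset$ (product topology,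 pointwise structure), with the continuous structure-preserving maps as morphisms. For $\mathbf{A}\in\mathcal{A}$, $\mathrm{D}(\mathbf{A})$ is the set of homomorphisms $\mathbf{A}\to\mathbf{M}$ as a substructure of $\widetilde{\mathbf{M}}^{A}$; for $\mathbf{X}\in\mathcal{X}$, $\mathrm{E}(\mathbf{X})$ is the set of morphisms $\mathbf{X}\to\widetilde{\mathbf{M}}$ as a subalgebra of $\mathbf{M}^X$. Assume that $\widetilde{\mathbf{M}}$ yields a strong duality on $\mathcal{A}$: all evaluation maps $\mathbf{A}\to\mathrm{ED}(\mathbf{A})$ ($\mathbf{A}\in\mathcal{A}$) and $\mathbf{X}\to\mathrm{DE}(\mathbf{X})$ ($\mathbf{X}\in\mathcal{X}$) are surjective, hence isomorphisms, and $\widetilde{\mathbf{M}}$ is injective in $\mathcal{X}$, i.e. whenever $\phi\colon\mathbf{X}\to\mathbf{Y}$ is an embedding in $\mathcal{X}$ (an isomorphism onto a substructure), every morphism $\mathbf{X}\to\widetilde{\mathbf{M}}$ factors through $\phi$. Proposition. Let $\mathbf{B}$ and $\mathbf{C}$ be finite algebras in $\mathcal{A}$. Then the following are equivalent: (1) $\mathbf{C}\in\mathbb{ISP}(\mathbf{B})$;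 (2) there exist $m\ge 0$ and homomorphisms $f_1,\dots,f_m\colon\mathbf{C}\to\mathbf{B}$ such that $f\colon a\mapsto(f_1(a),\dots,f_m(a))$ is an injective homomorphism from $\mathbf{C}$ into $\mathbf{B}^m$; (3) there exist $m\ge 0$ and morphisms $\phi_1,\dots,\phi_m\in\mathcal{X}(\mathrm{D}(\mathbf{B}),\mathrm{D}(\mathbf{C}))$ such that $\mathrm{D}(\mathbf{C})=\langle\mathrm{im}(\phi_1)\cup\dots\cup\mathrm{im}(\phi_m)\rangle$. -/

import Mathlib

open FirstOrder FirstOrder.Language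

universe u v w

namespace NatDual

/-! ### Algebras: powers and the class `ISP` -/

section Algebras

variable {L : FirstOrder.Language.{v, w}}

/-- The power `M ^ I` of an `L`-algebra, with coordinatewise structure. -/
instance powStructure (I : Type*) (M : Type*) [L.Structure M] : L.Structure (I → M) where
  funMap F x := fun i => Structure.funMap F (fun k => x k i)
  RelMap R x := ∀ i, Structure.RelMap R (fun k => x k i)

/-- `C ∈ ISP(B)`: the algebra `C` is isomorphic to a (non-empty) subalgebra of a power of `B`.
The empty power, a one-element algebra, is allowed. -/
def InISP (L : FirstOrder.Language.{v, w}) (B C : Type u) [L.Structure B] [L.Structure C] : Prop :=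
  ∃ (I : Type u) (S : L.Substructure (I → B)),
    (S : Set (I → B)).Nonempty ∧ Nonempty (L.Equiv C S)

end Algebras

/-! ### Structured topological spaces with total operations, partial operations and relations -/

/-- A type `(G, H, R)` of structures: symbols for total operations (of arity `≥ 0`), partial
operations (of arity `≥ 1`) and relations (of arity `≥ 1`). -/
structure Signature where
  Op : Type*
  POp : Type*
  Rel : Type*
  opArity : Op → ℕ
  popArity : POp → ℕ
  relArity : Rel → ℕ
  popArity_pos : ∀ h, 0 < popArity h
  relArity_pos : ∀ r, 0 < relArity r

variable {σ : Signature}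

/-- A topological structure of type `σ`. -/
structure TopStr (σ : Signature) where
  carrier : Type u
  top : TopologicalSpace carrier
  op : ∀ g : σ.Op, (Fin (σ.opArity g) → carrier) → carrier
  popDom : ∀ h : σ.POp, Set (Fin (σ.popArity h) → carrier)
  pop : ∀ (h : σ.POp) (x : Fin (σ.popArity h) → carrier), x ∈ popDom h → carrier
  rel : ∀ r : σ.Rel, Set (Fin (σ.relArity r) → carrier)

instance : CoeSort (TopStr.{u} σ) (Type u) := ⟨TopStr.carrier⟩

instance (X : TopStr.{u} σ) : TopologicalSpace X := X.top

/-- Continuous structure-preserving maps. -/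
structure IsMorphism (X Y : TopStr.{u} σ) (φ : X → Y) : Prop where
  continuous : Continuous φ
  map_op : ∀ g x, φ (X.op g x) = Y.op g (fun i => φ (x i))
  map_pop : ∀ h x (hx : x ∈ X.popDom h),
    ∃ hy : (fun i => φ (x i)) ∈ Y.popDom h, φ (X.pop h x hx) = Y.pop h (fun i => φ (x i)) hy
  map_rel : ∀ r x, x ∈ X.rel r → (fun i => φ (x i)) ∈ Y.rel r

/-- The set `𝒳(X, Y)` of morphisms. -/
def Mor (X Y : TopStr.{u} σ) : Type u := {φ : X → Y // IsMorphism X Y φ}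

instance (X Y : TopStr.{u} σ) : CoeFun (Mor X Y) (fun _ => X → Y) := ⟨Subtype.val⟩

/-- A morphism is an isomorphism if it has a two-sided inverse that is a morphism. -/
def Mor.IsIso {X Y : TopStr.{u} σ} (φ : Mor X Y) : Prop :=
  ∃ ψ : Mor Y X, (∀ x, ψ (φ x) = x) ∧ ∀ y, φ (ψ y) = y

/-- A substructure of `X`: a subset closed under the total and the partial operations. It may be
empty (if there are no nullary operations). -/
structure SubStr (X : TopStr.{u} σ) where
  carrier : Set X
  op_mem : ∀ g x, (∀ i, x i ∈ carrier) → X.op g x ∈ carrier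
  pop_mem : ∀ h x (hx : x ∈ X.popDom h), (∀ i, x i ∈ carrier) → X.pop h x hx ∈ carrier

/-- A substructure with the induced topology, operations, partial operations and relations. -/
def SubStr.toTopStr {X : TopStr.{u} σ} (Z : SubStr X) : TopStr.{u} σ where
  carrier := Z.carrier
  top := inferInstance
  op g x := ⟨X.op g (fun i => (x i : X)), Z.op_mem g _ (fun i => (x i).2)⟩
  popDom h := {x | (fun i => (x i : X)) ∈ X.popDom h}
  pop h x hx := ⟨X.pop h (fun i => (x i : X)) hx, Z.pop_mem h _ hx (fun i => (x i).2)⟩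
  rel r := {x | (fun i => (x i : X)) ∈ X.rel r}

/-- `⟨s⟩`, the smallest substructure of `X` that contains `s`. -/
def SubStr.generate {X : TopStr.{u} σ} (s : Set X) : SubStr X where
  carrier := {x | ∀ Z : SubStr X, s ⊆ Z.carrier → x ∈ Z.carrier}
  op_mem g x hx Z hZ := Z.op_mem g x (fun i => hx i Z hZ)
  pop_mem h x hd hx Z hZ := Z.pop_mem h x hd (fun i => hx i Z hZ)

/-- `φ : X → Y` is an embedding: `φ(X)` is a substructure of `Y` and `φ : X → φ(X)` is an
isomorphism. -/
def Mor.IsEmbedding {X Y : TopStr.{u} σ} (φ : Mor X Y) : Prop :=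
  ∃ (Z : SubStr Y) (e : Mor X Z.toTopStr), e.IsIso ∧ ∀ x, Subtype.val (e x) = φ x

/-- The power `X ^ S`, with the product topology and everything lifted pointwise. -/
def TopStr.pow (X : TopStr.{u} σ) (S : Type u) : TopStr.{u} σ where
  carrier := S → X
  top := inferInstance
  op g x := fun s => X.op g (fun i => x i s)
  popDom h := {x | ∀ s, (fun i => x i s) ∈ X.popDom h}
  pop h x hx := fun s => X.pop h (fun i => x i s) (hx s)
  rel r := {x | ∀ s, (fun i => x i s) ∈ X.rel r}

/-- `X ∈ IS_cP(T)`: `X` is isomorphic to a closed (possibly empty) substructure of a non-empty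
power of `T`. -/
def InIScP (T X : TopStr.{u} σ) : Prop :=
  ∃ (S : Type u) (_ : Nonempty S) (Z : SubStr (T.pow S)) (e : Mor X Z.toTopStr),
    IsClosed Z.carrier ∧ e.IsIso

/-! ### Alter egos and the hom-functors -/

/-- An alter ego of the algebra `M`, of type `σ`: total operations `M ^ n → M` that are
homomorphisms, partial operations that are homomorphisms from a subalgebra of `M ^ n` to `M`, and
relations that are (universes of) subalgebras of `M ^ n`. -/
structure AlterEgo (L : FirstOrder.Language.{v, w}) (σ : Signature) (M : Type u)
    [L.Structure M] where
  op : ∀ g : σ.Op, L.Hom (Fin (σ.opArity g) → M) M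
  popDom : ∀ h : σ.POp, L.Substructure (Fin (σ.popArity h) → M)
  pop : ∀ h : σ.POp, L.Hom (popDom h) M
  rel : ∀ r : σ.Rel, L.Substructure (Fin (σ.relArity r) → M)

namespace AlterEgo

variable {L : FirstOrder.Language.{v, w}} {M : Type u} [L.Structure M] (T : AlterEgo L σ M)

/-- The alter ego as a discrete topological structure on the set `M`. -/
def space : TopStr.{u} σ where
  carrier := M
  top := ⊥
  op g := T.op g
  popDom h := (T.popDom h : Set (Fin (σ.popArity h) → M))
  pop h x hx := T.pop h ⟨x, hx⟩
  rel r := (T.rel r : Set (Fin (σ.relArity r) → M))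

/-- The set of homomorphisms from `A` to `M` as a substructure of the power of the alter ego
indexed by `A`. -/
def homs [L.IsAlgebraic] (A : Type u) [L.Structure A] : SubStr (T.space.pow A) where
  carrier := {x | ∃ f : L.Hom A M, ⇑f = x}
  op_mem g x hx := by
    choose f hf using hx
    refine ⟨⟨fun a => T.op g (fun i => f i a), ?_, ?_⟩, ?_⟩
    · intro n F a
      have := (T.op g).map_fun F (fun k i => f i (a k))
      rw [Function.comp_def] at this
      rw [Function.comp_def, ← this]
      congr 1
      funext i
      exact (f i).map_fun F a
    · intro n r
      exact isEmptyElim r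
    · funext a
      change T.op g (fun i => f i a) = T.op g (fun i => x i a)
      simp only [hf]
  pop_mem h x hd hx := by
    choose f hf using hx
    have hd' : ∀ a, (fun i => f i a) ∈ T.popDom h := by
      intro a
      simp only [hf]
      exact hd a
    refine ⟨⟨fun a => T.pop h ⟨fun i => f i a, hd' a⟩, ?_, ?_⟩, ?_⟩
    · intro n F a
      have := (T.pop h).map_fun F (fun k => ⟨fun i => f i (a k), hd' (a k)⟩)
      rw [Function.comp_def] at this
      rw [Function.comp_def, ← this]
      congr 1
      apply Subtype.ext
      funext i
      exact (f i).map_fun F a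
    · intro n r
      exact isEmptyElim r
    · funext a
      change T.pop h ⟨fun i => f i a, _⟩ = T.pop h ⟨fun i => x i a, _⟩
      simp only [hf]

/-- The natural dual space `D(A)` of the algebra `A`: the set of homomorphisms `A → M`, structured
as a substructure of the power of the alter ego indexed by `A`. -/
def D [L.IsAlgebraic] (A : Type u) [L.Structure A] : TopStr.{u} σ := (T.homs A).toTopStr

/-- The algebra `E(X)` of morphisms from `X` to the alter ego, a subalgebra of `M ^ X`. -/
def E (X : TopStr.{u} σ) : L.Substructure (X → M) where
  carrier := {f | IsMorphism X T.space f}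
  fun_mem {n} F f hf := by
    have hf' : ∀ k, IsMorphism X T.space (f k) := hf
    refine ⟨?_, ?_, ?_, ?_⟩
    · let _ : TopologicalSpace M := ⊥
      have : DiscreteTopology M := ⟨rfl⟩
      have h1 : Continuous (fun x : X => fun k => f k x) :=
        continuous_pi fun k => (hf' k).continuous
      exact (continuous_of_discreteTopology (f := fun y : Fin n → M => Structure.funMap F y)).comp
        h1
    · intro g x
      have := (T.op g).map_fun F (fun k i => f k (x i))
      refine Eq.trans ?_ this.symm
      change Structure.funMap F (fun k => f k (X.op g x)) = _
      congr 1
      funext k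
      exact (hf' k).map_op g x
    · intro h x hx
      have hd : ∀ k, (fun i => f k (x i)) ∈ T.popDom h := fun k => ((hf' k).map_pop h x hx).1
      refine ⟨(T.popDom h).fun_mem F (fun k i => f k (x i)) hd, ?_⟩
      have := (T.pop h).map_fun F (fun k => ⟨fun i => f k (x i), hd k⟩)
      refine Eq.trans ?_ this.symm
      change Structure.funMap F (fun k => f k (X.pop h x hx)) = _
      congr 1
      funext k
      exact ((hf' k).map_pop h x hx).2
    · intro r x hx
      exact (T.rel r).fun_mem F (fun k i => f k (x i)) (fun k => (hf' k).map_rel r x hx)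

variable [L.IsAlgebraic]

/-- Evaluation at `a ∈ A` is a morphism from `D(A)` to the alter ego. -/
theorem isMorphism_eval {A : Type u} [L.Structure A] (a : A) :
    IsMorphism (T.D A) T.space (fun x => x.1 a) where
  continuous := (continuous_apply (A := fun _ : A => T.space) a).comp continuous_subtype_val
  map_op _ _ := rfl
  map_pop _ _ hx := ⟨hx a, rfl⟩
  map_rel _ _ hx := hx a

/-- The evaluation map `e_A : A → ED(A)`, `a ↦ (x ↦ x(a))`. -/
def e (A : Type u) [L.Structure A] (a : A) : T.E (T.D A) :=
  ⟨fun x => x.1 a, T.isMorphism_eval a⟩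

/-- The evaluation map `ε_X : X → DE(X)`, `x ↦ (f ↦ f(x))`. -/
def ε (X : TopStr.{u} σ) (x : X) : T.D (T.E X) :=
  ⟨fun f => f.1 x, ⟨⟨fun f => f.1 x, fun _ _ => rfl, fun r => isEmptyElim r⟩, rfl⟩⟩

/-- The alter ego yields a duality on `ISP(M)`: every `e_A` is surjective. -/
def YieldsDuality : Prop :=
  ∀ (A : Type u) [L.Structure A], InISP L M A → Function.Surjective (T.e A)

/-- The alter ego yields a full duality on `ISP(M)`: moreover every `ε_X` is surjective. -/
def YieldsFullDuality : Prop :=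
  T.YieldsDuality ∧ ∀ X : TopStr.{u} σ, InIScP T.space X → Function.Surjective (T.ε X)

/-- The alter ego is injective in the category `IS_cP` that it generates: morphisms into it extend
along embeddings. -/
def IsInjective : Prop :=
  ∀ X Y : TopStr.{u} σ, InIScP T.space X → InIScP T.space Y →
    ∀ φ : Mor X Y, φ.IsEmbedding → ∀ α : Mor X T.space, ∃ β : Mor Y T.space, ∀ x, β (φ x) = α x

/-- The alter ego yields a strong duality on `ISP(M)`: the duality is full and the alter ego is
injective. -/
def YieldsStrongDuality : Prop :=
  T.YieldsFullDuality ∧ T.IsInjective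

end AlterEgo

end NatDual

namespace NatDual

section Algebras

variable {L : FirstOrder.Language.{v, w}}

/-! (1) and (2) agree because a finite algebra has finitely many pairs of points to separate, so
finitely many homomorphisms into `B` suffice. Duality turns homomorphisms `f i : C → B` into
morphisms `φ i : D(B) → D(C)` and back (`dualMap`, `exists_hom`). As `D(B)` separates the points of
`B`, the `f i` jointly separate `a, b ∈ C` iff some point in the image of some `φ i` does. The
points not separating `a` and `b` form a substructure (`equalizer`), so images that generate `D(C)`
separate all points of `C`; this needs the duality only. The converse, `eq_univ_of_separating`, is
where strongness enters: a proper substructure of `D(C)` cannot separate the points of `C`. -/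

theorem InISP.nonempty {B C : Type u} [L.Structure B] [L.Structure C] (h : InISP L B C) :
    Nonempty C := by
  obtain ⟨I, S, ⟨s, hs⟩, ⟨e⟩⟩ := h
  exact ⟨e.symm ⟨s, hs⟩⟩

/-- Homomorphisms into `B` separate the points of an algebra in `ISP(B)`. -/
theorem InISP.exists_hom_ne [L.IsAlgebraic] {B C : Type u} [L.Structure B] [L.Structure C]
    (h : InISP L B C) {a b : C} (hab : a ≠ b) : ∃ f : L.Hom C B, f a ≠ f b := by
  obtain ⟨I, S, -, ⟨e⟩⟩ := h
  by_contra! hf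
  refine hab (e.injective (Subtype.ext (funext fun i => ?_)))
  refine hf ⟨fun c => (e c).1 i, fun F x => ?_, fun r => isEmptyElim r⟩
  exact congrArg (fun s : S => s.1 i) (e.map_fun F x)

/-- An algebra that embeds in a finite power of `B` belongs to `ISP(B)`. -/
theorem InISP.of_injective [L.IsAlgebraic] {B C : Type u} [L.Structure B] [L.Structure C]
    [Nonempty C] {m : ℕ} (F : L.Hom C (Fin m → B)) (hF : Function.Injective F) :
    InISP L B C := by
  -- `InISP` takes its index set in `Type u`, hence the lift of `Fin m`.
  let G : L.Hom C (ULift.{u} (Fin m) → B) :=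
    ⟨fun c i => F c i.down, fun f x => by
      funext i
      exact congrFun (F.map_fun f x) i.down, fun r => isEmptyElim r⟩
  have hG : Function.Injective G := fun a b hab =>
    hF (funext fun i => congrFun hab (ULift.up i))
  refine ⟨ULift.{u} (Fin m), G.range, ?_,
    ⟨⟨Equiv.ofInjective G hG, fun f x => ?_, fun r => isEmptyElim r⟩⟩⟩
  · exact ⟨G (Classical.arbitrary C), Set.mem_range_self _⟩
  · exact Subtype.ext (G.map_fun f x)

/-- A finite algebra in `ISP(B)` embeds in a finite power of `B`. -/
theorem InISP.exists_embedding [L.IsAlgebraic] {B C : Type u} [L.Structure B] [L.Structure C]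
    [Finite C] (h : InISP L B C) :
    ∃ (m : ℕ) (f : Fin m → L.Hom C B) (F : L.Hom C (Fin m → B)),
      (∀ a, F a = fun i => f i a) ∧ Function.Injective F := by
  -- One homomorphism per ordered pair of distinct points; `m` counts these pairs and is `0` when
  -- `C` is trivial.
  choose f hf using fun p : {p : C × C // p.1 ≠ p.2} => h.exists_hom_ne p.2
  obtain ⟨m, ⟨e⟩⟩ := Finite.exists_equiv_fin {p : C × C // p.1 ≠ p.2}
  refine ⟨m, fun i => f (e.symm i), ⟨fun a i => f (e.symm i) a, fun F x => ?_,
    fun r => isEmptyElim r⟩, fun _ => rfl, fun a b hab => ?_⟩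
  · funext i
    exact (f (e.symm i)).map_fun F x
  · by_contra hne
    apply hf ⟨(a, b), hne⟩
    have := congrFun hab (e ⟨(a, b), hne⟩)
    change f (e.symm (e _)) a = f (e.symm (e _)) b at this
    rwa [e.symm_apply_apply] at this

end Algebras

variable {σ : Signature}

theorem SubStr.subset_generate {X : TopStr.{u} σ} (s : Set X) : s ⊆ (generate s).carrier :=
  fun _ hx _ hZ => hZ hx

theorem IsMorphism.comp {X Y Z : TopStr.{u} σ} {ψ : Y → Z} {φ : X → Y} (hψ : IsMorphism Y Z ψ)
    (hφ : IsMorphism X Y φ) : IsMorphism X Z (fun x => ψ (φ x)) where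
  continuous := hψ.continuous.comp hφ.continuous
  map_op g x := by rw [hφ.map_op, hψ.map_op]
  map_pop h x hx := by
    obtain ⟨hy, e⟩ := hφ.map_pop h x hx
    obtain ⟨hz, e'⟩ := hψ.map_pop h _ hy
    exact ⟨hz, by rw [e, e']⟩
  map_rel r x hx := hψ.map_rel r _ (hφ.map_rel r x hx)

theorem isMorphism_id (X : TopStr.{u} σ) : IsMorphism X X (fun x => x) :=
  ⟨continuous_id, fun _ _ => rfl, fun _ _ hx => ⟨hx, rfl⟩, fun _ _ hx => hx⟩

/-- The inclusion of a substructure. -/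
def SubStr.incl {X : TopStr.{u} σ} (Z : SubStr X) : Mor Z.toTopStr X :=
  ⟨Subtype.val, continuous_subtype_val (X := X), fun _ _ => rfl, fun _ _ hx => ⟨hx, rfl⟩, fun _ _ hx => hx⟩

theorem SubStr.isEmbedding_incl {X : TopStr.{u} σ} (Z : SubStr X) : Z.incl.IsEmbedding :=
  ⟨Z, ⟨_, isMorphism_id _⟩, ⟨⟨_, isMorphism_id _⟩, fun _ => rfl, fun _ => rfl⟩, fun _ => rfl⟩

/-- A substructure of a substructure of `X`, as a substructure of `X`. -/
def SubStr.trans {X : TopStr.{u} σ} (Y : SubStr X) (Z : SubStr Y.toTopStr) : SubStr X where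
  carrier := {x | ∃ h : x ∈ Y.carrier, (⟨x, h⟩ : Y.carrier) ∈ Z.carrier}
  op_mem g x hx :=
    ⟨Y.op_mem g x fun i => (hx i).1, Z.op_mem g (fun i => ⟨x i, (hx i).1⟩) fun i => (hx i).2⟩
  pop_mem h x hd hx :=
    ⟨Y.pop_mem h x hd fun i => (hx i).1,
      Z.pop_mem h (fun i => ⟨x i, (hx i).1⟩) hd fun i => (hx i).2⟩

/-- Membership in `InIScP` asks for a substructure of a power itself, whereas substructures of
`D(A)` are nested one level deeper. -/
theorem SubStr.exists_iso_trans {X : TopStr.{u} σ} (Y : SubStr X) (Z : SubStr Y.toTopStr) :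
    ∃ e : Mor Z.toTopStr (Y.trans Z).toTopStr, e.IsIso := by
  refine ⟨⟨fun z => ⟨z.1.1, z.1.2, z.2⟩, ?_, fun _ _ => rfl, fun _ _ hx => ⟨hx, rfl⟩,
    fun _ _ hx => hx⟩, ⟨fun z => ⟨⟨z.1, z.2.1⟩, z.2.2⟩, ?_, fun _ _ => rfl,
    fun _ _ hx => ⟨hx, rfl⟩, fun _ _ hx => hx⟩, fun _ => rfl, fun _ => rfl⟩
  · exact Continuous.subtype_mk (Y.incl.2.continuous.comp Z.incl.2.continuous) _
  · exact Continuous.subtype_mk (Continuous.subtype_mk (Y.trans Z).incl.2.continuous _) _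

namespace AlterEgo

variable {L : FirstOrder.Language.{v, w}} {M : Type u} [L.Structure M] (T : AlterEgo L σ M)

theorem isClosed_of_finite [Finite M] {S : Type u} [Finite S] (s : Set (T.space.pow S)) :
    IsClosed s := by
  have : DiscreteTopology T.space := ⟨rfl⟩
  have : Finite T.space := ‹Finite M›
  have hs : Set.Finite (α := S → T.space) s := Set.toFinite _
  exact hs.isClosed

variable [L.IsAlgebraic]

section

variable {A : Type u} [L.Structure A]

theorem inIScP_subStr_D [Finite M] [Finite A] [Nonempty A] (Z : SubStr (T.D A)) :
    InIScP T.space Z.toTopStr := by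
  obtain ⟨e, he⟩ := (T.homs A).exists_iso_trans Z
  exact ⟨A, inferInstance, _, e, T.isClosed_of_finite _, he⟩

theorem inIScP_D [Finite M] [Finite A] [Nonempty A] : InIScP T.space (T.D A) :=
  ⟨A, inferInstance, T.homs A, ⟨_, isMorphism_id _⟩, T.isClosed_of_finite _,
    ⟨_, isMorphism_id _⟩, fun _ => rfl, fun _ => rfl⟩

/-- A homomorphism `A → M` as a point of `D(A)`. -/
def point (f : L.Hom A M) : T.D A := ⟨(f : A → M), f, rfl⟩

theorem D_ext {a b : A} (hA : InISP L M A) (h : ∀ x : T.D A, x.1 a = x.1 b) : a = b := by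
  by_contra hab
  obtain ⟨f, hf⟩ := hA.exists_hom_ne hab
  exact hf (h (T.point f))

/-- The points of `D(A)` at which the evaluations at `a` and `b` agree. -/
def equalizer (a b : A) : SubStr (T.D A) where
  carrier := {x | x.1 a = x.1 b}
  op_mem g x hx := congrArg (T.op g) (funext hx)
  pop_mem h x hd hx := by
    change T.pop h ⟨fun i => (x i).1 a, _⟩ = T.pop h ⟨fun i => (x i).1 b, _⟩
    congr 2
    exact funext hx

/-- The dual `D(f) : D(B) → D(A)` of a homomorphism `f : A → B`. -/
def dualMap {B : Type u} [L.Structure B] (f : L.Hom A B) : Mor (T.D B) (T.D A) :=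
  ⟨fun y => ⟨fun a => y.1 (f a), y.2.elim fun g hg => ⟨g.comp f, hg ▸ rfl⟩⟩,
    Continuous.subtype_mk (continuous_pi fun a => (T.isMorphism_eval (f a)).continuous) _,
    fun _ _ => rfl, fun _ _ hx => ⟨fun a => hx (f a), rfl⟩, fun _ _ hx a => hx (f a)⟩

/-- Under a strong duality, a substructure of the dual of a finite algebra that separates the
points of the algebra is the whole dual. -/
theorem YieldsStrongDuality.eq_univ_of_separating {T : AlterEgo L σ M}
    (hT : T.YieldsStrongDuality) [Finite M] [Finite A] (hA : InISP L M A) (Z : SubStr (T.D A))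
    (hZ : ∀ a b : A, (∀ x ∈ Z.carrier, x.1 a = x.1 b) → a = b) : Z.carrier = Set.univ := by
  -- `D(A)` lies in a power indexed by `A`, and `InIScP` requires a non-empty index set.
  have : Nonempty A := hA.nonempty
  have hZX := T.inIScP_subStr_D Z
  -- Injectivity extends `α` to all of `D(A)`, where the duality makes it an evaluation.
  have hext : ∀ α : T.E Z.toTopStr, ∃ a : A, ∀ z : Z.carrier, z.1.1 a = α.1 z := by
    intro α
    obtain ⟨β, hβ⟩ := hT.2 _ _ hZX T.inIScP_D Z.incl Z.isEmbedding_incl ⟨α.1, α.2⟩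
    obtain ⟨a, ha⟩ := hT.1.1 A hA ⟨β.1, β.2⟩
    exact ⟨a, fun z => (congrFun (congrArg Subtype.val ha) z.1).trans (hβ z)⟩
  choose r hr using hext
  -- Operations of `E(Z)` are pointwise and points of `Z` are homomorphisms, so both sides agree at
  -- every point of `Z`, which separates `A`.
  have r_hom : ∀ {n} (F : L.Functions n) (α : Fin n → T.E Z.toTopStr),
      r (Structure.funMap F α) = Structure.funMap F (fun k => r (α k)) := by
    intro n F α
    refine hZ _ _ fun x hx => ?_
    rw [hr _ ⟨x, hx⟩]
    obtain ⟨f, hf⟩ := x.2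
    rw [← hf]
    refine Eq.trans ?_ (f.map_fun F _).symm
    change Structure.funMap F (fun k => (α k).1 ⟨x, hx⟩) = _
    congr 1
    funext k
    rw [← hr (α k) ⟨x, hx⟩, ← hf]
    rfl
  refine Set.eq_univ_of_forall fun x => ?_
  obtain ⟨f, hf⟩ := x.2
  -- Pulled back along `r`, the point `f` is a homomorphism on `E(Z)`; by fullness it is evaluation
  -- at some `z` in `Z`. Testing on restricted evaluations gives `x = z`.
  let p : L.Hom (T.E Z.toTopStr) M :=
    ⟨fun α => f (r α), fun F α => by
      rw [r_hom]
      exact f.map_fun F _, fun r => isEmptyElim r⟩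
  obtain ⟨z, hz⟩ := hT.1.2 _ hZX (T.point p)
  have hxz : x = z.1 := by
    refine Subtype.ext (funext fun a => ?_)
    let α : T.E Z.toTopStr := ⟨fun z => z.1.1 a, (T.isMorphism_eval a).comp Z.incl.2⟩
    have hα : r α = a := hZ _ _ fun x hx => hr α ⟨x, hx⟩
    have := congrFun (congrArg Subtype.val hz) α
    change z.1.1 a = f (r α) at this
    rw [this, hα, ← hf]
  rw [hxz]
  exact z.2

/-- Under a duality, every morphism `D(B) → D(A)` is the dual of a homomorphism `A → B`. -/
theorem YieldsDuality.exists_hom {T : AlterEgo L σ M} (hT : T.YieldsDuality) {B : Type u}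
    [L.Structure B] (hB : InISP L M B) (φ : Mor (T.D B) (T.D A)) :
    ∃ f : L.Hom A B, ∀ (y : T.D B) (a : A), y.1 (f a) = (φ y).1 a := by
  -- Evaluation at `a` after `φ` is a morphism from `D(B)` to the alter ego, hence evaluation at
  -- some `b`.
  have hex : ∀ a : A, ∃ b : B, ∀ y : T.D B, y.1 b = (φ y).1 a := by
    intro a
    obtain ⟨b, hb⟩ := hT B hB ⟨_, (T.isMorphism_eval a).comp φ.2⟩
    exact ⟨b, fun y => congrFun (congrArg Subtype.val hb) y⟩
  choose f hf using hex
  refine ⟨⟨f, fun F a => T.D_ext hB fun y => ?_, fun r => isEmptyElim r⟩, fun y a => hf a y⟩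
  rw [hf]
  obtain ⟨g, hg⟩ := y.2
  obtain ⟨k, hk⟩ := (φ y).2
  rw [← hg, ← hk]
  refine (k.map_fun F a).trans (Eq.trans ?_ (g.map_fun F _).symm)
  congr 1
  funext i
  change k (a i) = g (f (a i))
  rw [hk, hg, hf]

end

end AlterEgo

end NatDual

theorem proposition5p2 {L : FirstOrder.Language.{v, w}} [L.IsAlgebraic]
    {M : Type u} [L.Structure M] [Finite M] [Nonempty M]
    {σ : NatDual.Signature} (T : NatDual.AlterEgo L σ M) (hT : T.YieldsStrongDuality)
    (B C : Type u) [L.Structure B] [L.Structure C] [Finite B] [Finite C]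
    (hB : NatDual.InISP L M B) (hC : NatDual.InISP L M C) :
    List.TFAE [
      NatDual.InISP L B C,
      ∃ (m : ℕ) (f : Fin m → L.Hom C B) (F : L.Hom C (Fin m → B)),
        (∀ a, F a = fun i => f i a) ∧ Function.Injective F,
      ∃ (m : ℕ) (φ : Fin m → NatDual.Mor (T.D B) (T.D C)),
        (NatDual.SubStr.generate (⋃ i, Set.range (φ i))).carrier = Set.univ] := by
  have : Nonempty C := hC.nonempty
  tfae_have 1 → 2 := fun h => h.exists_embedding
  tfae_have 2 → 1 := fun ⟨_, _, F, _, hF⟩ => NatDual.InISP.of_injective F hF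
  tfae_have 2 → 3 := by
    rintro ⟨m, f, F, hf, hF⟩
    refine ⟨m, fun i => T.dualMap (f i), hT.eq_univ_of_separating hC _ fun a b hab => hF ?_⟩
    rw [hf, hf]
    funext i
    exact T.D_ext hB fun y => hab (T.dualMap (f i) y)
      (NatDual.SubStr.subset_generate _ (Set.mem_iUnion.2 ⟨i, y, rfl⟩))
  tfae_have 3 → 2 := by
    rintro ⟨m, φ, hφ⟩
    choose f hf using fun i => hT.1.1.exists_hom hB (φ i)
    refine ⟨m, f, ⟨fun a i => f i a, fun F x => ?_, fun r => isEmptyElim r⟩, fun _ => rfl,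
      fun a b hab => T.D_ext hC fun x => ?_⟩
    · funext i
      exact (f i).map_fun F x
    · have hx : x ∈ (NatDual.SubStr.generate (⋃ i, Set.range (φ i))).carrier := by
        rw [hφ]
        exact Set.mem_univ x
      -- The equalizer contains every image, since `f i a = f i b` for all `i`; hence it contains
      -- the generated substructure.
      refine hx (T.equalizer a b) (Set.iUnion_subset fun i => ?_)
      rintro _ ⟨y, rfl⟩
      change (φ i y).1 a = (φ i y).1 b
      rw [← hf, ← hf]
      exact congrArg y.1 (congrFun hab i)
  tfae_finish
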